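/- All graphs are finite and simple. Let $X$ be a graph with adjacency relation $E(X)$. Let $C(\mathrm{Qut}(X))$ be the universal unital $C^*$-algebra generated by elements $u_{ij}$ ($i,j\in V(X)$) subject to the relations $u_{ij}^2=u_{ij}^*=u_{ij}$, $\sum_{k}u_{ik}=\sum_k u_{kj}=1$ for all $i,j$, and $u_{ij}u_{k\ell}=0$ whenever exactly one of $ik\in E(X)$, $j\ell\in E(X)$ holds. The graph $X$ is called quantum vertex transitive if $u_{xx'}\neq 0$ in $C(\mathrm{Qut}(X))$ for all $x,x'\in V(X)$. Two vertices of $X$ are twins if they have the same neighbourhood; this is an equivalence relation on $V(X)$, and $X$ has no twins if no two distinct vertices are twins. The lexicographic product $X[Y]$ is the graph on $V(X)\times V(Y)$ in which $(x,y)$ and $(x',y')$ are adjacent if and only if $xx'\in E(X)$, or $x=x'$ and $yy'\in E(Y)$. Lemma. Let $X$ be a quantum vertex transitive graph. Then there is a positive integer $\alpha$ such that every equivalence class of the twin relation on $V(X)$ has exactly $\alpha$ elements, and there exists a quantum vertex transitive graph $X'$ with no twins such that $X\cong X'[\overline{K_\alpha}]$, where $\overline{K_\alpha}$ is the edgeless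 graph on $\alpha$ vertices. -/

import Mathlib

open scoped ComplexConjugate

/-! ### Twins and lexicographic products of simple graphs -/

namespace SimpleGraph

/-- Two vertices are twins if they have the same neighbourhood. -/
def IsTwin {V : Type*} (X : SimpleGraph V) (x y : V) : Prop :=
  X.neighborSet x = X.neighborSet y

/-- Being twins, as an equivalence relation on the vertex set. -/
def twinSetoid {V : Type*} (X : SimpleGraph V) : Setoid V where
  r := X.IsTwin
  iseqv := ⟨fun _ => rfl, fun h => Eq.symm h, fun h h' => Eq.trans h h'⟩

/-- A graph has no twins if no two distinct vertices are twins. -/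
def TwinFree {V : Type*} (X : SimpleGraph V) : Prop :=
  ∀ x y : V, X.IsTwin x y → x = y

/-- The lexicographic product `X[Y]`. -/
def lexProduct {V W : Type*} (X : SimpleGraph V) (Y : SimpleGraph W) : SimpleGraph (V × W) where
  Adj p q := X.Adj p.1 q.1 ∨ (p.1 = q.1 ∧ Y.Adj p.2 q.2)
  symm := ⟨fun _ _ h => h.imp (fun h => h.symm) (fun h => ⟨h.1.symm, h.2.symm⟩)⟩
  loopless := ⟨fun _ h => h.elim (fun h => X.loopless.irrefl _ h)
    (fun h => Y.loopless.irrefl _ h.2)⟩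

end SimpleGraph

/-! ### The universal C*-algebra generated by projections subject to relations -/

/-- The free unital complex algebra on `G`. With the star operation below it is the free unital
`*`-algebra on the self-adjoint generators `G`. -/
def FreeSA (G : Type*) : Type _ := FreeAlgebra ℂ G

namespace FreeSA

variable {G : Type*}

noncomputable instance : Ring (FreeSA G) := inferInstanceAs (Ring (FreeAlgebra ℂ G))

noncomputable instance : Algebra ℂ (FreeSA G) := inferInstanceAs (Algebra ℂ (FreeAlgebra ℂ G))

/-- The generator of the free algebra labelled by `g`. -/
noncomputable def gen (g : G) : FreeSA G := FreeAlgebra.ι ℂ g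

/-- The algebra homomorphism determined by its values on the generators. -/
noncomputable def lift {A : Type*} [Ring A] [Algebra ℂ A] (f : G → A) : FreeSA G →ₐ[ℂ] A :=
  FreeAlgebra.lift ℂ f

theorem lift_gen {A : Type*} [Ring A] [Algebra ℂ A] (f : G → A) (g : G) :
    lift f (gen g) = f g := FreeAlgebra.lift_ι_apply f g

theorem induction {motive : FreeSA G → Prop}
    (scalar : ∀ c : ℂ, motive (algebraMap ℂ (FreeSA G) c)) (gen : ∀ g, motive (gen g))
    (mul : ∀ a b, motive a → motive b → motive (a * b))
    (add : ∀ a b, motive a → motive b → motive (a + b)) (a : FreeSA G) : motive a :=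
  FreeAlgebra.induction ℂ G scalar gen mul add a

/-- The opposite algebra with scalars acting through complex conjugation. -/
@[reducible]
noncomputable def conjOpAlgebra : Algebra ℂ (FreeSA G)ᵐᵒᵖ :=
  ((algebraMap ℂ (FreeSA G)ᵐᵒᵖ).comp (starRingEnd ℂ)).toAlgebra'
    (fun c x => Algebra.commutes (conj c) x)

/-- The conjugate-linear anti-homomorphism that fixes the generators. -/
noncomputable def starHom : FreeSA G →+* (FreeSA G)ᵐᵒᵖ :=
  letI : Algebra ℂ (FreeSA G)ᵐᵒᵖ := conjOpAlgebra
  (FreeAlgebra.lift ℂ (fun g => MulOpposite.op (gen g)) :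
    FreeAlgebra ℂ G →ₐ[ℂ] (FreeSA G)ᵐᵒᵖ).toRingHom

theorem starHom_gen (g : G) : starHom (gen g) = MulOpposite.op (gen g) := by
  let _ : Algebra ℂ (FreeSA G)ᵐᵒᵖ := conjOpAlgebra
  exact FreeAlgebra.lift_ι_apply (R := ℂ) (A := (FreeSA G)ᵐᵒᵖ) _ g

theorem starHom_algebraMap (c : ℂ) : starHom (algebraMap ℂ (FreeSA G) c) =
    MulOpposite.op (algebraMap ℂ (FreeSA G) (conj c)) := by
  let _ : Algebra ℂ (FreeSA G)ᵐᵒᵖ := conjOpAlgebra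
  exact (FreeAlgebra.lift ℂ (fun g => MulOpposite.op (gen g)) :
    FreeAlgebra ℂ G →ₐ[ℂ] (FreeSA G)ᵐᵒᵖ).commutes c

noncomputable instance : StarRing (FreeSA G) where
  star a := (starHom a).unop
  star_involutive a := by
    induction a using FreeSA.induction with
    | scalar c => simp [starHom_algebraMap]
    | gen g => simp [starHom_gen]
    | mul a b ha hb => simp [ha, hb]
    | add a b ha hb => simp [ha, hb]
  star_mul a b := by simp
  star_add a b := by simp

theorem star_def (a : FreeSA G) : star a = (starHom a).unop := rfl

theorem star_gen (g : G) : star (gen g) = gen g := by simp [star_def, starHom_gen]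

theorem star_algebraMap (c : ℂ) :
    star (algebraMap ℂ (FreeSA G) c) = algebraMap ℂ (FreeSA G) (conj c) := by
  simp [star_def, starHom_algebraMap]

instance : StarModule ℂ (FreeSA G) where
  star_smul c a := by
    rw [Algebra.smul_def, star_mul, star_algebraMap, ← Algebra.commutes, ← Algebra.smul_def]
    rfl

theorem lift_star {A : Type*} [CStarAlgebra A] (f : G → A) (hf : ∀ g, star (f g) = f g)
    (a : FreeSA G) : lift f (star a) = star (lift f a) := by
  induction a using FreeSA.induction with
  | scalar c => rw [star_algebraMap, AlgHom.commutes, AlgHom.commutes, ← algebraMap_star_comm]; rfl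
  | gen g => rw [star_gen, lift_gen, hf]
  | mul a b ha hb => rw [star_mul, map_mul, map_mul, star_mul, ha, hb]
  | add a b ha hb => rw [star_add, map_add, map_add, star_add, ha, hb]

end FreeSA

/-- The C*-seminorms on the free `*`-algebra on `G` for which the generators are idempotent
and the elements of `R` vanish. -/
structure ProjCStarSeminorm {G : Type*} (R : Set (FreeSA G)) extends Seminorm ℂ (FreeSA G) where
  mul_le (a b : FreeSA G) : toSeminorm (a * b) ≤ toSeminorm a * toSeminorm b
  star_mul_self (a : FreeSA G) : toSeminorm (star a * a) = toSeminorm a ^ 2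
  idem (g : G) : toSeminorm (FreeSA.gen g * FreeSA.gen g - FreeSA.gen g) = 0
  rel (r : FreeSA G) (hr : r ∈ R) : toSeminorm r = 0

namespace ProjCStarSeminorm

variable {G : Type*} {R : Set (FreeSA G)}

noncomputable instance : Inhabited (ProjCStarSeminorm R) :=
  ⟨{ toSeminorm := 0
     mul_le := by simp
     star_mul_self := by simp
     idem := by simp
     rel := by simp }⟩

theorem le_one_of_sq {t : ℝ} (h : t = t ^ 2) : t ≤ 1 := by nlinarith [sq_nonneg (t - 1)]

theorem one_le (p : ProjCStarSeminorm R) : p.toSeminorm 1 ≤ 1 :=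
  le_one_of_sq (by simpa using p.star_mul_self 1)

theorem gen_le (p : ProjCStarSeminorm R) (g : G) : p.toSeminorm (FreeSA.gen g) ≤ 1 := by
  have h1 := p.star_mul_self (FreeSA.gen g)
  rw [FreeSA.star_gen] at h1
  have h2 := p.idem g
  have h3 := map_sub_le_add p.toSeminorm (FreeSA.gen g * FreeSA.gen g - FreeSA.gen g)
    (FreeSA.gen g * FreeSA.gen g)
  rw [sub_sub_cancel_left, map_neg_eq_map] at h3
  nlinarith [sq_nonneg (p.toSeminorm (FreeSA.gen g) - 1),
    le_map_add_map_sub p.toSeminorm (FreeSA.gen g * FreeSA.gen g) (FreeSA.gen g),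
    map_sub_rev p.toSeminorm (FreeSA.gen g * FreeSA.gen g) (FreeSA.gen g),
    map_add_le_add p.toSeminorm (FreeSA.gen g * FreeSA.gen g - FreeSA.gen g) (FreeSA.gen g),
    congrArg p.toSeminorm (sub_add_cancel (FreeSA.gen g * FreeSA.gen g) (FreeSA.gen g))]

theorem star_le (p : ProjCStarSeminorm R) (a : FreeSA G) :
    p.toSeminorm a ≤ p.toSeminorm (star a) := by
  have h := p.star_mul_self a ▸ p.mul_le (star a) a
  have h0 := apply_nonneg p.toSeminorm a
  have h1 := apply_nonneg p.toSeminorm (star a)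
  by_contra! hlt
  nlinarith

theorem star_eq (p : ProjCStarSeminorm R) (a : FreeSA G) :
    p.toSeminorm (star a) = p.toSeminorm a :=
  le_antisymm (by simpa using p.star_le (star a)) (p.star_le a)

theorem bddAbove (R : Set (FreeSA G)) (a : FreeSA G) :
    BddAbove (Set.range fun p : ProjCStarSeminorm R => p.toSeminorm a) := by
  suffices h : ∃ C : ℝ, ∀ p : ProjCStarSeminorm R, p.toSeminorm a ≤ C by
    obtain ⟨C, hC⟩ := h
    exact ⟨C, by rintro _ ⟨p, rfl⟩; exact hC p⟩
  induction a using FreeSA.induction with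
  | scalar c =>
    refine ⟨‖c‖ * 1, fun p => ?_⟩
    rw [Algebra.algebraMap_eq_smul_one, map_smul_eq_mul]
    exact mul_le_mul_of_nonneg_left p.one_le (norm_nonneg c)
  | gen g => exact ⟨1, fun p => p.gen_le g⟩
  | mul a b ha hb =>
    obtain ⟨C, hC⟩ := ha
    obtain ⟨D, hD⟩ := hb
    refine ⟨C * D, fun p => (p.mul_le a b).trans ?_⟩
    exact mul_le_mul (hC p) (hD p) (apply_nonneg _ _) ((apply_nonneg _ _).trans (hC p))
  | add a b ha hb =>
    obtain ⟨C, hC⟩ := ha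
    obtain ⟨D, hD⟩ := hb
    exact ⟨C + D, fun p => (map_add_le_add p.toSeminorm a b).trans (add_le_add (hC p) (hD p))⟩

/-- The universal C*-seminorm: the supremum of all C*-seminorms that respect the relations. -/
noncomputable def univ (R : Set (FreeSA G)) (a : FreeSA G) : ℝ :=
  ⨆ p : ProjCStarSeminorm R, p.toSeminorm a

theorem le_univ (p : ProjCStarSeminorm R) (a : FreeSA G) : p.toSeminorm a ≤ univ R a :=
  le_ciSup (bddAbove R a) p

theorem univ_nonneg (R : Set (FreeSA G)) (a : FreeSA G) : 0 ≤ univ R a :=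
  (apply_nonneg (default : ProjCStarSeminorm R).toSeminorm a).trans (le_univ _ a)

/-- The universal C*-seminorm, bundled as a ring seminorm. -/
noncomputable def univRing (R : Set (FreeSA G)) : RingSeminorm (FreeSA G) where
  toFun := univ R
  map_zero' := by simp [univ]
  add_le' a b := ciSup_le fun p =>
    (map_add_le_add p.toSeminorm a b).trans (add_le_add (p.le_univ a) (p.le_univ b))
  neg' a := by simp [univ]
  mul_le' a b := ciSup_le fun p => (p.mul_le a b).trans
    (mul_le_mul (p.le_univ a) (p.le_univ b) (apply_nonneg _ _) (univ_nonneg R a))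

theorem univ_smul_le (R : Set (FreeSA G)) (c : ℂ) (a : FreeSA G) :
    univ R (c • a) ≤ ‖c‖ * univ R a := ciSup_le fun p => by
  rw [map_smul_eq_mul]
  exact mul_le_mul_of_nonneg_left (p.le_univ a) (norm_nonneg c)

theorem univ_star (R : Set (FreeSA G)) (a : FreeSA G) : univ R (star a) = univ R a := by
  simp [univ, star_eq]

theorem univ_mul_self_le (R : Set (FreeSA G)) (a : FreeSA G) :
    univ R a * univ R a ≤ univ R (star a * a) := by
  have h : univ R a ≤ Real.sqrt (univ R (star a * a)) := ciSup_le fun p =>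
    Real.le_sqrt_of_sq_le (p.star_mul_self a ▸ p.le_univ (star a * a))
  calc univ R a * univ R a ≤ Real.sqrt (univ R (star a * a)) * Real.sqrt (univ R (star a * a)) :=
        mul_le_mul h h (univ_nonneg R a) (Real.sqrt_nonneg _)
    _ = _ := Real.mul_self_sqrt (univ_nonneg R _)

theorem univ_rel {r : FreeSA G} (hr : r ∈ R) : univ R r = 0 := by
  simp [univ, ProjCStarSeminorm.rel _ r hr]

theorem univ_idem (R : Set (FreeSA G)) (g : G) :
    univ R (FreeSA.gen g * FreeSA.gen g - FreeSA.gen g) = 0 := by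
  simp [univ, ProjCStarSeminorm.idem]

end ProjCStarSeminorm

/-- The free `*`-algebra on `G`, seminormed by the universal C*-seminorm for `R`. -/
def PreUnivCStar {G : Type*} (_R : Set (FreeSA G)) : Type _ := FreeSA G

namespace PreUnivCStar

variable {G : Type*} (R : Set (FreeSA G))

noncomputable instance : SeminormedRing (PreUnivCStar R) :=
  (ProjCStarSeminorm.univRing R).toSeminormedRing

noncomputable instance : StarRing (PreUnivCStar R) := inferInstanceAs (StarRing (FreeSA G))

noncomputable instance : NormedAlgebra ℂ (PreUnivCStar R) where
  __ := (inferInstanceAs (Algebra ℂ (FreeSA G)) : Algebra ℂ (FreeSA G))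
  norm_smul_le := ProjCStarSeminorm.univ_smul_le R

instance : StarModule ℂ (PreUnivCStar R) := inferInstanceAs (StarModule ℂ (FreeSA G))

instance : NormedStarGroup (PreUnivCStar R) where
  norm_star_le a := (ProjCStarSeminorm.univ_star R a).le

end PreUnivCStar

/-- The universal unital C*-algebra generated by projections labelled by `G`, subject to the
relations `r = 0` for `r ∈ R`: the separated completion of the free `*`-algebra. -/
abbrev UnivCStar {G : Type*} (R : Set (FreeSA G)) : Type _ :=
  UniformSpace.Completion (PreUnivCStar R)

namespace UnivCStar

open UniformSpace

variable {G : Type*} (R : Set (FreeSA G))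

noncomputable instance : Star (UnivCStar R) where
  star := Completion.map (star : PreUnivCStar R → PreUnivCStar R)

theorem uniformContinuous_star : UniformContinuous (star : PreUnivCStar R → PreUnivCStar R) :=
  star_isometry.uniformContinuous

theorem star_coe (a : PreUnivCStar R) : star (a : UnivCStar R) = ((star a : PreUnivCStar R) :) :=
  Completion.map_coe (uniformContinuous_star R) a

theorem continuous_star' : Continuous (star : UnivCStar R → UnivCStar R) :=
  Completion.continuous_map

noncomputable instance : StarRing (UnivCStar R) where
  star_involutive a := by
    have h := continuous_star' R
    induction a using Completion.induction_on with
    | hp => exact isClosed_eq (by fun_prop) (by fun_prop)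
    | ih a => rw [star_coe, star_coe, star_star]
  star_mul a b := by
    have h := continuous_star' R
    induction a, b using Completion.induction_on₂ with
    | hp => exact isClosed_eq (by fun_prop) (by fun_prop)
    | ih a b => rw [← Completion.coe_mul, star_coe, star_coe, star_coe, star_mul,
        Completion.coe_mul]
  star_add a b := by
    have h := continuous_star' R
    induction a, b using Completion.induction_on₂ with
    | hp => exact isClosed_eq (by fun_prop) (by fun_prop)
    | ih a b => rw [← Completion.coe_add, star_coe, star_coe, star_coe, star_add,
        Completion.coe_add]

noncomputable instance : CStarAlgebra (UnivCStar R) where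
  norm_smul_le c a := norm_smul_le c a
  norm_mul_self_le a := by
    have h := continuous_star' R
    induction a using Completion.induction_on with
    | hp => exact isClosed_le (by fun_prop) (by fun_prop)
    | ih a =>
      rw [star_coe, ← Completion.coe_mul, Completion.norm_coe, Completion.norm_coe]
      exact ProjCStarSeminorm.univ_mul_self_le R a
  star_smul c a := by
    have h := continuous_star' R
    induction a using Completion.induction_on with
    | hp => exact isClosed_eq (h.comp (continuous_const_smul c)) (h.const_smul (star c))
    | ih a => rw [← Completion.coe_smul, star_coe, star_coe, star_smul, Completion.coe_smul]

/-- The canonical `*`-homomorphism from the free `*`-algebra to the universal C*-algebra. -/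
noncomputable def mk : FreeSA G →⋆ₐ[ℂ] UnivCStar R where
  toFun a := ((show PreUnivCStar R from a : PreUnivCStar R) : UnivCStar R)
  map_one' := Completion.coe_one (PreUnivCStar R)
  map_mul' := Completion.coe_mul (α := PreUnivCStar R)
  map_zero' := Completion.coe_zero (α := PreUnivCStar R)
  map_add' := Completion.coe_add (α := PreUnivCStar R)
  commutes' _ := rfl
  map_star' a := (star_coe R a).symm

theorem norm_mk (a : FreeSA G) : ‖mk R a‖ = ProjCStarSeminorm.univ R a :=
  Completion.norm_coe (E := PreUnivCStar R) a

theorem mk_rel {r : FreeSA G} (hr : r ∈ R) : mk R r = 0 := by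
  rw [← norm_eq_zero, norm_mk, ProjCStarSeminorm.univ_rel hr]

theorem denseRange_mk : DenseRange (mk R) :=
  Completion.denseRange_coe (α := PreUnivCStar R)

/-- The projection labelled by `g` in the universal C*-algebra. -/
noncomputable def gen (g : G) : UnivCStar R := mk R (FreeSA.gen g)

theorem isStarProjection_gen (g : G) : IsStarProjection (gen R g) where
  isIdempotentElem := by
    rw [IsIdempotentElem, ← sub_eq_zero, gen, ← map_mul, ← map_sub, ← norm_eq_zero, norm_mk,
      ProjCStarSeminorm.univ_idem]
  isSelfAdjoint := by
    rw [IsSelfAdjoint, gen, ← map_star, FreeSA.star_gen]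

/-- The universal property: projections in a C*-algebra that satisfy the relations are the image
of the universal ones under a `*`-homomorphism. -/
theorem exists_lift {A : Type*} [CStarAlgebra A] (f : G → A) (hf : ∀ g, IsStarProjection (f g))
    (hR : ∀ r ∈ R, FreeSA.lift f r = 0) :
    ∃ φ : UnivCStar R →⋆ₐ[ℂ] A, ∀ g, φ (gen R g) = f g := by
  have hs := FreeSA.lift_star f (fun g => (hf g).isSelfAdjoint)
  let p : ProjCStarSeminorm R :=
    { toSeminorm := (normSeminorm ℂ A).comp (FreeSA.lift f).toLinearMap
      mul_le a b := by simpa using norm_mul_le (FreeSA.lift f a) (FreeSA.lift f b)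
      star_mul_self a := by
        simpa [hs, sq] using CStarRing.norm_star_mul_self (x := FreeSA.lift f a)
      idem g := by simp [FreeSA.lift_gen, (hf g).isIdempotentElem.eq]
      rel r hr := by simp [hR r hr] }
  have hp (a : PreUnivCStar R) : ‖FreeSA.lift f a‖ ≤ ‖a‖ := p.le_univ a
  let ψ : PreUnivCStar R →+* A := (FreeSA.lift f).toRingHom
  have hψ : Continuous ψ := AddMonoidHomClass.continuous_of_bound ψ 1
    (fun a => (hp a).trans (one_mul _).ge)
  let Ψ : UnivCStar R →+* A := Completion.extensionHom ψ hψ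
  have hΨ : Continuous Ψ := Completion.continuous_extension
  have hc (a : FreeSA G) : Ψ (mk R a) = FreeSA.lift f a :=
    Completion.extensionHom_coe ψ hψ a
  refine ⟨{ Ψ with
    commutes' := fun c => ?_
    map_star' := fun a => ?_ }, fun g => ?_⟩
  · exact (hc (algebraMap ℂ _ c)).trans ((FreeSA.lift f).commutes c)
  · change Ψ (star a) = star (Ψ a)
    refine congrFun ((denseRange_mk R).equalizer (hΨ.comp (continuous_star' R)) hΨ.star
      (funext fun b => ?_)) a
    change Ψ (star (mk R b)) = star (Ψ (mk R b))
    rw [← map_star, hc, hc, hs]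
  · exact (hc _).trans (FreeSA.lift_gen f g)

end UnivCStar

/-! ### Quantum automorphism groups of finite graphs -/

/-- A magic unitary: a square matrix of projections whose rows and columns sum to `1`. -/
structure IsMagicUnitary {V A : Type*} [Fintype V] [CStarAlgebra A] (u : Matrix V V A) :
    Prop where
  isStarProjection (i j : V) : IsStarProjection (u i j)
  row_sum (i : V) : ∑ k, u i k = 1
  col_sum (j : V) : ∑ k, u k j = 1

namespace SimpleGraph

variable {V : Type*} [Fintype V] (X : SimpleGraph V)

/-- The defining relations of `C(Qut(X))` between the projections `u i j`: rows and columns sum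
to `1`, and `u i j * u k l = 0` if exactly one of `ik` and `jl` is an edge. -/
inductive QutRel : FreeSA (V × V) → Prop
  | row (i : V) : QutRel (∑ k, FreeSA.gen (i, k) - 1)
  | col (j : V) : QutRel (∑ k, FreeSA.gen (k, j) - 1)
  | edge_nonedge (i j k l : V) (hik : X.Adj i k) (hjl : ¬ X.Adj j l) :
      QutRel (FreeSA.gen (i, j) * FreeSA.gen (k, l))
  | nonedge_edge (i j k l : V) (hik : ¬ X.Adj i k) (hjl : X.Adj j l) :
      QutRel (FreeSA.gen (i, j) * FreeSA.gen (k, l))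

/-- The universal C*-algebra `C(Qut(X))` of the quantum automorphism group of `X`. -/
abbrev CQut : Type _ := UnivCStar {r | X.QutRel r}

/-- The fundamental representation of the quantum automorphism group of `X`. -/
noncomputable def qutRep : Matrix V V X.CQut :=
  Matrix.of fun i j => UnivCStar.gen {r | X.QutRel r} (i, j)

theorem isMagicUnitary_qutRep : IsMagicUnitary X.qutRep where
  isStarProjection i j := UnivCStar.isStarProjection_gen _ (i, j)
  row_sum i := by
    have h := UnivCStar.mk_rel {r | X.QutRel r} (QutRel.row i)
    rwa [map_sub, map_sum, map_one, sub_eq_zero] at h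
  col_sum j := by
    have h := UnivCStar.mk_rel {r | X.QutRel r} (QutRel.col j)
    rwa [map_sub, map_sum, map_one, sub_eq_zero] at h

theorem qutRep_mul_eq_zero {i j k l : V} (h : ¬ (X.Adj i k ↔ X.Adj j l)) :
    X.qutRep i j * X.qutRep k l = 0 := by
  refine (map_mul (UnivCStar.mk {r | X.QutRel r}) _ _).symm.trans (UnivCStar.mk_rel _ ?_)
  by_cases hik : X.Adj i k
  · exact QutRel.edge_nonedge i j k l hik (by tauto)
  · exact QutRel.nonedge_edge i j k l hik (by tauto)

/-- The universal property of `C(Qut(X))`. -/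
theorem exists_qutRep_lift {A : Type*} [CStarAlgebra A] (u : Matrix V V A)
    (hu : IsMagicUnitary u)
    (hX : ∀ i j k l : V, ¬ (X.Adj i k ↔ X.Adj j l) → u i j * u k l = 0) :
    ∃ φ : X.CQut →⋆ₐ[ℂ] A, ∀ i j, φ (X.qutRep i j) = u i j := by
  obtain ⟨φ, hφ⟩ := UnivCStar.exists_lift {r | X.QutRel r} (fun g : V × V => u g.1 g.2)
    (fun g => hu.isStarProjection g.1 g.2) (by
      rintro r (⟨i⟩ | ⟨j⟩ | ⟨i, j, k, l, hik, hjl⟩ | ⟨i, j, k, l, hik, hjl⟩)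
      · simp [FreeSA.lift_gen, hu.row_sum]
      · simp [FreeSA.lift_gen, hu.col_sum]
      · rw [map_mul, FreeSA.lift_gen, FreeSA.lift_gen]
        exact hX i j k l (by tauto)
      · rw [map_mul, FreeSA.lift_gen, FreeSA.lift_gen]
        exact hX i j k l (by tauto))
  exact ⟨φ, fun i j => hφ (i, j)⟩

/-- A graph is quantum vertex transitive if `Qut(X)` acts on the vertices with a single orbit:
every entry of the fundamental representation is nonzero. -/
def QuantumVertexTransitive : Prop :=
  ∀ x y : V, X.qutRep x y ≠ 0

end SimpleGraph

/-! The fundamental representation `u` respects twins: `u i j * u k l = 0` when exactly one of the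
pairs `i, k` and `j, l` consists of twins. So summing a row of `u` over a twin class gives a
projection that depends only on the class of the row index, and likewise for columns. Adding up a
block indexed by classes `a`, `b` by rows and by columns gives `|a| • p = |b| • q` with projections
`p`, `q`. Under quantum transitivity `p` is nonzero, hence `|a| = |b|`. With equal class sizes, `p =
q`, so the class sums form a magic unitary indexed by the twin quotient and satisfying its edge
relations. The universal property maps the generators of the quotient to these nonzero sums, so the
quotient is quantum vertex transitive. Blowing up each of its vertices into `α` twins recovers `X`.
-/

namespace IsMagicUnitary

variable {V W A : Type*} [Fintype V] [DecidableEq W] [CStarAlgebra A] {u : Matrix V V A}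

theorem transpose (hu : IsMagicUnitary u) : IsMagicUnitary u.transpose where
  isStarProjection i j := hu.isStarProjection j i
  row_sum i := hu.col_sum i
  col_sum j := hu.row_sum j

/-- Projections are positive, so no cancellation can occur in the sum. -/
theorem sum_ne_zero (hu : IsMagicUnitary u) {s : Finset V} {x y : V} (hy : y ∈ s)
    (h : u x y ≠ 0) : ∑ k ∈ s, u x k ≠ 0 := by
  let _ := CStarAlgebra.spectralOrder A
  have := CStarAlgebra.spectralOrderedRing A
  intro h0
  rw [Finset.sum_eq_zero_iff_of_nonneg fun k _ => (hu.isStarProjection x k).nonneg] at h0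
  exact h (h0 y hy)

/-! ### Fibre sums of a magic unitary compatible with a partition -/

variable {c : V → W}

theorem fiberSum_mul_fiberSum_of_ne
    (hc : ∀ i j k l, ¬ (c i = c k ↔ c j = c l) → u i j * u k l = 0)
    {x x' : V} (hx : c x = c x') {a b : W} (hab : a ≠ b) :
    (∑ y with c y = a, u x y) * ∑ y with c y = b, u x' y = 0 := by
  rw [Finset.sum_mul_sum]
  refine Finset.sum_eq_zero fun y hy => Finset.sum_eq_zero fun y' hy' => hc _ _ _ _ ?_
  simp only [Finset.mem_filter, Finset.mem_univ, true_and] at hy hy'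
  simp [hx, hy, hy', hab]

theorem sum_fiberSum [Fintype W] (hu : IsMagicUnitary u) (c : V → W) (x : V) :
    ∑ a, ∑ y with c y = a, u x y = 1 := by
  rw [Finset.sum_fiberwise, hu.row_sum]

/-- Expand `1` as the sum of all fibre sums of row `x'`; every term with `b ≠ a` is killed. -/
theorem fiberSum_mul_fiberSum [Fintype W] (hu : IsMagicUnitary u)
    (hc : ∀ i j k l, ¬ (c i = c k ↔ c j = c l) → u i j * u k l = 0)
    {x x' : V} (hx : c x = c x') (a : W) :
    (∑ y with c y = a, u x y) * ∑ y with c y = a, u x' y = ∑ y with c y = a, u x y := by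
  conv_rhs => rw [← mul_one (∑ y with c y = a, u x y), ← hu.sum_fiberSum c x', Finset.mul_sum]
  exact (Finset.sum_eq_single_of_mem a (Finset.mem_univ a)
    fun b _ hb => fiberSum_mul_fiberSum_of_ne hc hx hb.symm).symm

theorem isStarProjection_fiberSum [Fintype W] (hu : IsMagicUnitary u)
    (hc : ∀ i j k l, ¬ (c i = c k ↔ c j = c l) → u i j * u k l = 0) (x : V) (a : W) :
    IsStarProjection (∑ y with c y = a, u x y) where
  isIdempotentElem := hu.fiberSum_mul_fiberSum hc rfl a
  isSelfAdjoint := isSelfAdjoint_sum _ fun y _ => (hu.isStarProjection x y).isSelfAdjoint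

/-- The fibre sums of a row of a magic unitary depend only on the fibre of the row index. -/
theorem fiberSum_congr [Fintype W] (hu : IsMagicUnitary u)
    (hc : ∀ i j k l, ¬ (c i = c k ↔ c j = c l) → u i j * u k l = 0)
    {x x' : V} (hx : c x = c x') (a : W) :
    ∑ y with c y = a, u x y = ∑ y with c y = a, u x' y := by
  -- The adjoint of `p * q = p` is `q * p = p`, while exchanging `x` and `x'` gives `q * p = q`.
  have h := congrArg star (hu.fiberSum_mul_fiberSum hc hx a)
  rw [star_mul, (hu.isStarProjection_fiberSum hc x a).isSelfAdjoint.star_eq,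
    (hu.isStarProjection_fiberSum hc x' a).isSelfAdjoint.star_eq,
    hu.fiberSum_mul_fiberSum hc hx.symm a] at h
  exact h.symm

/-- Double counting: both sides are the total of the block indexed by the fibres of `x` and `y`. -/
theorem card_smul_fiberSum [Fintype W] (hu : IsMagicUnitary u)
    (hc : ∀ i j k l, ¬ (c i = c k ↔ c j = c l) → u i j * u k l = 0) (x y : V) :
    (Finset.univ.filter (c · = c x)).card • ∑ j with c j = c y, u x j =
      (Finset.univ.filter (c · = c y)).card • ∑ i with c i = c x, u i y := by
  have h1 : ∑ i with c i = c x, ∑ j with c j = c y, u i j =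
      (Finset.univ.filter (c · = c x)).card • ∑ j with c j = c y, u x j :=
    Finset.sum_eq_card_nsmul fun i hi => hu.fiberSum_congr hc (Finset.mem_filter.1 hi).2 _
  have h2 : ∑ j with c j = c y, ∑ i with c i = c x, u i j =
      (Finset.univ.filter (c · = c y)).card • ∑ i with c i = c x, u i y :=
    Finset.sum_eq_card_nsmul fun j hj => hu.transpose.fiberSum_congr
      (fun i j k l h => hc j i l k (fun h' => h h'.symm)) (Finset.mem_filter.1 hj).2 _
  rw [← h1, ← h2, Finset.sum_comm]

/-- Two proportional projections, one of which is nonzero, have ratio one. -/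
theorem eq_of_nsmul_eq_nsmul {p q : A} (hp : IsIdempotentElem p) (hq : IsIdempotentElem q)
    (hp0 : p ≠ 0) {m n : ℕ} (hm : m ≠ 0) (h : m • p = n • q) : m = n := by
  -- Squaring `m • p = n • q` gives `m² • p = n² • q`, and `n • q` is again `m • p`.
  have h1 : (m * m) • p = (n * m) • p := by
    calc (m * m) • p = (m • p) * (m • p) := by rw [smul_mul_smul_comm, hp.eq]
      _ = (n * n) • q := by rw [h, smul_mul_smul_comm, hq.eq]
      _ = (n * m) • p := by rw [mul_smul, ← h, mul_smul]
  have h2 : ((m * m : ℕ) : ℂ) • p = ((n * m : ℕ) : ℂ) • p := by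
    rw [Nat.cast_smul_eq_nsmul, Nat.cast_smul_eq_nsmul, h1]
  exact Nat.eq_of_mul_eq_mul_right (Nat.pos_of_ne_zero hm)
    (Nat.cast_injective (smul_left_injective ℂ hp0 h2))

variable [Fintype W]

theorem card_fiber_eq (hu : IsMagicUnitary u)
    (hc : ∀ i j k l, ¬ (c i = c k ↔ c j = c l) → u i j * u k l = 0) {x y : V}
    (h : u x y ≠ 0) :
    (Finset.univ.filter (c · = c x)).card = (Finset.univ.filter (c · = c y)).card :=
  eq_of_nsmul_eq_nsmul (hu.isStarProjection_fiberSum hc x (c y)).isIdempotentElem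
    (hu.transpose.isStarProjection_fiberSum
      (fun i j k l h => hc j i l k (fun h' => h h'.symm)) y (c x)).isIdempotentElem
    (hu.sum_ne_zero (by simp) h)
    (Finset.card_ne_zero_of_mem (a := x) (by simp)) (hu.card_smul_fiberSum hc x y)

/-- If all entries are nonzero, then the matrix of fibre sums is a magic unitary. -/
theorem fiberSum (hu : IsMagicUnitary u)
    (hc : ∀ i j k l, ¬ (c i = c k ↔ c j = c l) → u i j * u k l = 0)
    (hne : ∀ x y, u x y ≠ 0) {s : W → V} (hs : ∀ a, c (s a) = a) :
    IsMagicUnitary (Matrix.of fun a b => ∑ y with c y = b, u (s a) y) where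
  isStarProjection a b := hu.isStarProjection_fiberSum hc (s a) b
  row_sum a := hu.sum_fiberSum c (s a)
  col_sum b := by
    rw [← hu.transpose.sum_fiberSum c (s b)]
    refine Finset.sum_congr rfl fun a _ => ?_
    -- Since the fibres have equal size, the two coefficients cancel: the row sum over a fibre
    -- becomes a column sum over a fibre.
    have h := hu.card_smul_fiberSum hc (s a) (s b)
    rw [hu.card_fiber_eq hc (hne (s a) (s b)), ← Nat.cast_smul_eq_nsmul ℂ,
      ← Nat.cast_smul_eq_nsmul ℂ] at h
    have h' := smul_right_injective A
      (Nat.cast_ne_zero.2 (Finset.card_ne_zero_of_mem (a := s b) (by simp))) h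
    simpa [hs] using h'

end IsMagicUnitary

/-! ### Twins and the twin quotient -/

namespace SimpleGraph

variable {V : Type*} (X : SimpleGraph V)

theorem IsTwin.adj_iff {X : SimpleGraph V} {x y : V} (h : X.IsTwin x y) (z : V) :
    X.Adj x z ↔ X.Adj y z :=
  Set.ext_iff.1 h z

theorem exists_adj_iff_not_adj_of_not_isTwin {X : SimpleGraph V} {x y : V}
    (h : ¬ X.IsTwin x y) : ∃ z, ¬ (X.Adj x z ↔ X.Adj y z) := by
  by_contra! h'
  exact h (Set.ext h')

/-- If `i`, `k` are twins and `z` distinguishes `j` from `l`, insert `1 = ∑ w, u w z` between the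
factors. A surviving term would need `iw` to match `jz` and `kw` to match `lz`, but `iw` and `kw`
agree while `jz` and `lz` do not. The other case is symmetric, with a row sum. -/
theorem qutRep_mul_eq_zero_of_isTwin [Fintype V] {i j k l : V}
    (h : ¬ (X.IsTwin i k ↔ X.IsTwin j l)) : X.qutRep i j * X.qutRep k l = 0 := by
  by_cases hik : X.IsTwin i k
  · obtain ⟨z, hz⟩ := exists_adj_iff_not_adj_of_not_isTwin (X := X) (x := j) (y := l) (by tauto)
    rw [← mul_one (X.qutRep i j), ← X.isMagicUnitary_qutRep.col_sum z, Finset.mul_sum,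
      Finset.sum_mul]
    refine Finset.sum_eq_zero fun w _ => ?_
    have hw := hik.adj_iff w
    by_cases h1 : X.Adj i w ↔ X.Adj j z
    · rw [mul_assoc, X.qutRep_mul_eq_zero (i := w) (k := k), mul_zero]
      rw [X.adj_comm w, X.adj_comm z]
      tauto
    · rw [X.qutRep_mul_eq_zero h1, zero_mul]
  · have hjl : X.IsTwin j l := by tauto
    obtain ⟨z, hz⟩ := exists_adj_iff_not_adj_of_not_isTwin hik
    rw [← mul_one (X.qutRep i j), ← X.isMagicUnitary_qutRep.row_sum z, Finset.mul_sum,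
      Finset.sum_mul]
    refine Finset.sum_eq_zero fun w _ => ?_
    have hw := hjl.adj_iff w
    by_cases h1 : X.Adj i z ↔ X.Adj j w
    · rw [mul_assoc, X.qutRep_mul_eq_zero (i := z) (k := k), mul_zero]
      rw [X.adj_comm z, X.adj_comm w]
      tauto
    · rw [X.qutRep_mul_eq_zero h1, zero_mul]

theorem exists_twin_quotient [Finite V] :
    ∃ (k : ℕ) (c : V → Fin k), Function.Surjective c ∧ ∀ x y, c x = c y ↔ X.IsTwin x y := by
  obtain ⟨k, ⟨e⟩⟩ := Finite.exists_equiv_fin (Quotient X.twinSetoid)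
  refine ⟨k, fun x => e (Quotient.mk _ x), e.surjective.comp Quotient.mk_surjective,
    fun x y => ?_⟩
  rw [e.apply_eq_iff_eq, Quotient.eq]
  rfl

theorem adj_iff_of_isTwin {X : SimpleGraph V} {x x' y y' : V} (hx : X.IsTwin x x')
    (hy : X.IsTwin y y') : X.Adj x y ↔ X.Adj x' y' := by
  rw [hx.adj_iff, X.adj_comm, hy.adj_iff, X.adj_comm]

variable {X} {W : Type*} {c : V → W} {s : W → V}

/-- `X.comap s` realises the twin quotient on chosen representatives; replacing vertices by twins
does not change adjacency. -/
theorem comap_adj_iff (hc : ∀ x y, c x = c y ↔ X.IsTwin x y) (hs : ∀ a, c (s a) = a) (x y : V) :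
    (X.comap s).Adj (c x) (c y) ↔ X.Adj x y :=
  adj_iff_of_isTwin ((hc _ _).1 (hs _)) ((hc _ _).1 (hs _))

theorem twinFree_comap (hc : ∀ x y, c x = c y ↔ X.IsTwin x y) (hs : ∀ a, c (s a) = a) :
    (X.comap s).TwinFree := by
  intro a b hab
  rw [← hs a, ← hs b, hc]
  -- Every `z` is a twin of its representative, so agreement on representatives suffices.
  ext z
  have h := hab.adj_iff (c z)
  rwa [← hs a, ← hs b, comap_adj_iff hc hs, comap_adj_iff hc hs] at h

/-- A generator is nonzero if some homomorphism sends it to a nonzero element; here its image is a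
fibre sum of `X.qutRep`. -/
theorem QuantumVertexTransitive.comap [Fintype V] [Fintype W] (hX : X.QuantumVertexTransitive)
    (hc : ∀ x y, c x = c y ↔ X.IsTwin x y) (hs : ∀ a, c (s a) = a) :
    (X.comap s).QuantumVertexTransitive := by
  classical
  have hu := X.isMagicUnitary_qutRep
  obtain ⟨φ, hφ⟩ := (X.comap s).exists_qutRep_lift _
    (hu.fiberSum (c := c) (fun i j k l h => X.qutRep_mul_eq_zero_of_isTwin (by
      rwa [← hc, ← hc])) hX hs) (by
    intro i j k l h
    simp only [Matrix.of_apply]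
    rw [Finset.sum_mul_sum]
    refine Finset.sum_eq_zero fun y hy => Finset.sum_eq_zero fun y' hy' =>
      X.qutRep_mul_eq_zero ?_
    rw [← comap_adj_iff hc hs y y', (Finset.mem_filter.1 hy).2, (Finset.mem_filter.1 hy').2]
    exact h)
  intro a b h0
  have h := hφ a b
  rw [h0, map_zero] at h
  exact hu.sum_ne_zero (y := s b) (by simp [hs]) (hX (s a) (s b)) h.symm

/-- Any bijections of the fibres with `Fin α` work, because the second factor is edgeless and
adjacency sees only the class. -/
theorem nonempty_iso_lexProduct_compl_top [Fintype V] [DecidableEq W] {α : ℕ}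
    (hc : ∀ x y, c x = c y ↔ X.IsTwin x y) (hs : ∀ a, c (s a) = a)
    (hα : ∀ a, (Finset.univ.filter (c · = a)).card = α) :
    Nonempty (X ≃g (X.comap s).lexProduct (⊤ : SimpleGraph (Fin α))ᶜ) := by
  have e (a : W) : {x // c x = a} ≃ Fin α :=
    Fintype.equivFinOfCardEq ((Fintype.card_subtype _).trans (hα a))
  refine ⟨⟨(Equiv.sigmaFiberEquiv c).symm.trans (Equiv.sigmaEquivProdOfEquiv e), ?_⟩⟩
  intro x y
  simp only [lexProduct, compl_top, bot_adj, and_false, or_false]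
  exact comap_adj_iff hc hs x y

end SimpleGraph

theorem mainTheorem7 {V : Type*} [Fintype V] (X : SimpleGraph V)
    (hX : X.QuantumVertexTransitive) :
    ∃ α : ℕ, 0 < α ∧ (∀ C ∈ X.twinSetoid.classes, C.ncard = α) ∧
      ∃ (k : ℕ) (X' : SimpleGraph (Fin k)),
        X'.QuantumVertexTransitive ∧ X'.TwinFree ∧
        Nonempty (X ≃g X'.lexProduct (⊤ : SimpleGraph (Fin α))ᶜ) := by
  obtain ⟨k, c, hsurj, hc⟩ := X.exists_twin_quotient
  choose s hs using hsurj
  have hcard : ∃ α : ℕ, 0 < α ∧ ∀ a, (Finset.univ.filter (c · = a)).card = α := by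
    rcases isEmpty_or_nonempty V with hV | ⟨⟨x⟩⟩
    -- The empty graph has no classes, so any positive `α` would do.
    · exact ⟨1, one_pos, fun a => (hV.false (s a)).elim⟩
    · refine ⟨(Finset.univ.filter (c · = c x)).card, Finset.card_pos.2 ⟨x, by simp⟩, fun a => ?_⟩
      have h := X.isMagicUnitary_qutRep.card_fiber_eq (c := c) (fun i j k l h =>
        X.qutRep_mul_eq_zero_of_isTwin (by rwa [← hc, ← hc])) (hX (s a) x)
      rwa [hs] at h
  obtain ⟨α, hα0, hα⟩ := hcard
  refine ⟨α, hα0, ?_, k, X.comap s, hX.comap hc hs, SimpleGraph.twinFree_comap hc hs,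
    SimpleGraph.nonempty_iso_lexProduct_compl_top hc hs hα⟩
  rintro _ ⟨y, rfl⟩
  rw [← hα (c y), ← Set.ncard_coe_finset]
  congr 1
  ext x
  simp only [Finset.coe_filter, Finset.mem_univ, true_and, Set.mem_ofPred_eq, hc]
  rfl
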